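/- A real Banach space $X$ is said to have the uniform Mazur intersection property (UMIP) if for every $\varepsilon>0$ there exists $K>0$ such that for every nonempty closed bounded convex set $C\subseteq X$ and every $p\in X$ with $\operatorname{diam}(C)<1/\varepsilon$ and $d(p,C)\ge\varepsilon$, there is a closed ball $B[x_0,r_0]=\{y\in X:\|x_0-y\|\le r_0\}$ ($x_0\in X$, $r_0>0$) such that $C\subseteq B[x_0,r_0]$, $d(p,B[x_0,r_0])\ge\varepsilon/2$ and $r_0\le K$. Let $X$ be a real Banach space and $1<p<\infty$, and let $\ell_p(X)$ be the space of sequences $(x_i)_{i\in\mathbb N}$ in $X$ with $\sum_{i}\|x_i\|^p<\infty$, with the norm $\|(x_i)\|_p=\left(\sum_{i}\|x_i\|^p\right)^{1/p}$. Then $\ell_p(X)$ has the UMIP if and only if $X$ has the UMIP. -/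

import Mathlib

/-- The uniform Mazur intersection property: for every `ε > 0` there is `K > 0` such that every
nonempty closed bounded convex set `C` of diameter `< 1/ε` and every point `p` at distance `≥ ε`
from `C` can be separated by a closed ball of radius at most `K` that contains `C` and whose
distance from `p` is at least `ε/2`. -/
def HasUMIP (X : Type*) [NormedAddCommGroup X] [NormedSpace ℝ X] : Prop :=
  ∀ ε : ℝ, 0 < ε → ∃ K : ℝ, 0 < K ∧
    ∀ C : Set X, C.Nonempty → IsClosed C → Bornology.IsBounded C → Convex ℝ C →
      ∀ p : X, Metric.diam C < 1 / ε → ε ≤ Metric.infDist p C →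
        ∃ (x₀ : X) (r₀ : ℝ), 0 < r₀ ∧ r₀ ≤ K ∧ C ⊆ Metric.closedBall x₀ r₀ ∧
          ε / 2 ≤ Metric.infDist p (Metric.closedBall x₀ r₀)

/-! The UMIP is dualised: it holds exactly when, for each `ε`, slices of one fixed depth `δ`, cut
from the dual ball by unit vectors of the space, can be placed within `ε` of every norm-one
functional. One direction tests balls on `{‖w‖ ≤ 1, f w ≥ e}`; the other builds a large ball whose
centre lies far out along the slicing vector.

The dual condition passes from `X` to `ℓ_p(X)` because the dual is `ℓ_q(X*)`: it is recast as a
homogeneous bound of `‖f - g‖ ^ q` by a small multiple of `‖f‖ ^ q` plus the gap in Young's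
inequality, which can be summed over coordinates. Conversely, a ball of `ℓ_p(X)` meets a coordinate
copy of `X` in a ball, and Minkowski's inequality controls the separation. -/

/-! ### Distances to balls and almost norming vectors -/

theorem le_infDist_closedBall {X : Type*} [NormedAddCommGroup X] {p x : X}
    {r e : ℝ} (hr : 0 ≤ r) (h : r + e ≤ ‖x - p‖) :
    e ≤ Metric.infDist p (Metric.closedBall x r) := by
  rw [Metric.le_infDist (Metric.nonempty_closedBall.2 hr)]
  intro y hy
  rw [mem_closedBall_iff_norm] at hy
  rw [dist_eq_norm]
  have := norm_sub_le (y - p) (y - x)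
  rw [show y - p - (y - x) = x - p by abel] at this
  rw [norm_sub_rev p y]
  linarith

theorem add_le_norm_of_le_infDist_closedBall {X : Type*} [NormedAddCommGroup X] [NormedSpace ℝ X]
    {p x : X} {r e : ℝ} (hr : 0 ≤ r) (he : 0 < e)
    (h : e ≤ Metric.infDist p (Metric.closedBall x r)) : r + e ≤ ‖x - p‖ := by
  rw [Metric.le_infDist (Metric.nonempty_closedBall.2 hr)] at h
  have hlt : r < ‖p - x‖ := by
    by_contra hle
    have := h (mem_closedBall_iff_norm.2 (not_lt.1 hle))
    rw [dist_self] at this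
    linarith
  have hpos : 0 < ‖p - x‖ := hr.trans_lt hlt
  have hy : x + (r / ‖p - x‖) • (p - x) ∈ Metric.closedBall x r := by
    rw [mem_closedBall_iff_norm, add_sub_cancel_left, norm_smul, Real.norm_of_nonneg (by positivity),
      div_mul_cancel₀ _ hpos.ne']
  have h1 := h hy
  rw [dist_eq_norm, show p - (x + (r / ‖p - x‖) • (p - x)) = (1 - r / ‖p - x‖) • (p - x) by
    rw [sub_smul, one_smul]; abel, norm_smul, Real.norm_of_nonneg
      (by rw [sub_nonneg, div_le_one hpos]; exact hlt.le), sub_mul, one_mul,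
      div_mul_cancel₀ _ hpos.ne'] at h1
  rw [norm_sub_rev x p]
  linarith

theorem exists_norm_lt_one_lt_apply {X : Type*} [NormedAddCommGroup X] [NormedSpace ℝ X]
    (f : StrongDual ℝ X) {t : ℝ} (ht : t < ‖f‖) : ∃ u : X, ‖u‖ < 1 ∧ t < f u := by
  obtain ⟨u, hu, hfu⟩ := f.exists_lt_apply_of_lt_opNorm ht
  rcases le_total 0 (f u) with h | h
  · exact ⟨u, hu, by rwa [Real.norm_of_nonneg h] at hfu⟩
  · exact ⟨-u, by rwa [norm_neg], by rwa [Real.norm_of_nonpos h, ← map_neg] at hfu⟩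

/-! ### The dual form of the UMIP -/

/-- Every norm-one functional is, up to `ε`, the centre of a slice of the dual ball that is cut by
a unit vector of the space and has depth `δ = δ(ε)`. -/
def HasUniformlySemidentingDual (X : Type*) [NormedAddCommGroup X] [NormedSpace ℝ X] : Prop :=
  ∀ ε : ℝ, 0 < ε → ∃ δ : ℝ, 0 < δ ∧ ∀ f : StrongDual ℝ X, ‖f‖ = 1 →
    ∃ x : X, ‖x‖ = 1 ∧ ∀ g : StrongDual ℝ X, ‖g‖ ≤ 1 → 1 - δ < g x → ‖f - g‖ ≤ ε

/-- A quantitative parallel hyperplane lemma: a functional that is nonnegative on the part of the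
unit ball where `f ≥ e` and almost attains its norm bound is close to `f`. -/
theorem norm_sub_le_of_nonneg_on_slice {X : Type*} [NormedAddCommGroup X] [NormedSpace ℝ X]
    {f g : StrongDual ℝ X} (hf : ‖f‖ = 1) (hg : ‖g‖ ≤ 1) {e : ℝ} (he : 0 < e) (he4 : e ≤ 1 / 4)
    (hpos : ∀ w : X, ‖w‖ ≤ 1 → e ≤ f w → 0 ≤ g w) {x : X} (hx : ‖x‖ = 1) (hgx : 1 - e ≤ g x) :
    ‖f - g‖ ≤ 25 * e := by
  have hf' (v : X) : |f v| ≤ ‖v‖ := by simpa [hf] using f.le_opNorm v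
  have hg' (v : X) : |g v| ≤ ‖v‖ :=
    (g.le_opNorm v).trans (mul_le_of_le_one_left (norm_nonneg _) hg)
  obtain ⟨u, hu, hfu⟩ := exists_norm_lt_one_lt_apply f (t := 1 - e) (by rw [hf]; linarith)
  have hfu1 : f u ≤ 1 := (le_abs_self _).trans ((hf' u).trans hu.le)
  have hgu1 : g u ≤ 1 := (le_abs_self _).trans ((hg' u).trans hu.le)
  have hgu0 : 0 ≤ g u := hpos u hu.le (by linarith)
  have hker (z : X) (hz : ‖z‖ ≤ 3) (hfz : f z = 0) : -(12 * e) ≤ g z := by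
    -- The multiple of `u` lifts `f` to at least `e` while the norm stays at most 1. Nonnegativity
    -- of `g` there gives `g z ≥ -6e / (1 - 2e)`, and `e ≤ 1 / 4`.
    have := hpos (((1 - 2 * e) / 3) • z + (2 * e) • u) ?_ ?_
    · simp only [map_add, map_smul, smul_eq_mul] at this
      nlinarith
    · refine (norm_add_le _ _).trans ?_
      rw [norm_smul, norm_smul, Real.norm_of_nonneg (by linarith), Real.norm_of_nonneg (by linarith)]
      nlinarith
    · simp only [map_add, map_smul, smul_eq_mul, hfz]
      nlinarith
  have hfu0 : 0 < f u := by linarith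
  -- With this `a`, `g - a • f` kills `u`, so projecting along `u` onto `ker f` bounds it by `12e`
  -- on the unit ball; `|1 - a| ≤ 13e` then gives `25e`.
  set a := g u / f u with ha
  have haf : a * f u = g u := div_mul_cancel₀ _ hfu0.ne'
  have hproj (v : X) (hv : ‖v‖ ≤ 1) : -(12 * e) ≤ g v - a * f v := by
    have hb : |f v / f u| ≤ 2 := by
      rw [abs_div, abs_of_pos hfu0, div_le_iff₀ hfu0]
      linarith [hf' v]
    have := hker (v - (f v / f u) • u) ?_ ?_
    · simp only [map_sub, map_smul, smul_eq_mul] at this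
      rw [show a * f v = f v / f u * g u by rw [ha]; ring]
      exact this
    · refine (norm_sub_le _ _).trans ?_
      rw [norm_smul, Real.norm_eq_abs]
      nlinarith [norm_nonneg u, abs_nonneg (f v / f u)]
    · simp only [map_sub, map_smul, smul_eq_mul]
      rw [div_mul_cancel₀ _ hfu0.ne', sub_self]
  have hproj' (v : X) (hv : ‖v‖ ≤ 1) : g v - a * f v ≤ 12 * e := by
    have := hproj (-v) (by rwa [norm_neg])
    simp only [map_neg] at this
    linarith
  have ha0 : 0 ≤ a := by positivity
  have hau : a ≤ 1 + 2 * e := by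
    rw [ha, div_le_iff₀ hfu0]
    nlinarith
  have hal : 1 - 13 * e ≤ a := by
    have h1 := hproj' x hx.le
    have h2 := (le_abs_self _).trans (hf' x)
    nlinarith
  refine ContinuousLinearMap.opNorm_le_of_unit_norm (by positivity) fun v hv => ?_
  have h1 := hproj v hv.le
  have h2 := hproj' v hv.le
  have h3 := abs_le.1 (hf' v)
  rw [hv] at h3
  rw [sub_apply, Real.norm_eq_abs, abs_le]
  constructor <;> nlinarith

theorem HasUMIP.hasUniformlySemidentingDual {X : Type*} [NormedAddCommGroup X] [NormedSpace ℝ X]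
    (h : HasUMIP X) : HasUniformlySemidentingDual X := by
  intro ε hε
  set e := min (ε / 25) (1 / 4) with he_def
  have he : 0 < e := by positivity
  have he4 : e ≤ 1 / 4 := min_le_right _ _
  have heε : 25 * e ≤ ε := by linarith [min_le_left (ε / 25) (1 / 4)]
  obtain ⟨K, hK, hball⟩ := h e he
  -- Since `‖x₀‖ ≤ K + 1`, a `g` in this slice has `g x₀ > ‖x₀‖ - e / 4 > r₀`, hence is positive on
  -- the ball, which contains `C`.
  refine ⟨e / (4 * (K + 1)), by positivity, fun f hf => ?_⟩
  have hf' (v : X) : |f v| ≤ ‖v‖ := by simpa [hf] using f.le_opNorm v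
  obtain ⟨u, hu, hfu⟩ := exists_norm_lt_one_lt_apply f (t := 1 - e) (by rw [hf]; linarith)
  set C : Set X := Metric.closedBall 0 1 ∩ {w | e ≤ f w} with hC
  have huC : u ∈ C := ⟨by simpa using hu.le, by simp only [Set.mem_ofPred_eq]; linarith⟩
  obtain ⟨x₀, r₀, hr₀, hr₀K, hsub, hdist⟩ := hball C ⟨u, huC⟩
    (Metric.isClosed_closedBall.inter (isClosed_le continuous_const f.continuous))
    (Metric.isBounded_closedBall.subset Set.inter_subset_left)
    ((convex_closedBall 0 1).inter (convex_halfSpace_ge f.toLinearMap.isLinear e)) 0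
    (by
      calc Metric.diam C ≤ Metric.diam (Metric.closedBall (0 : X) 1) :=
            Metric.diam_mono Set.inter_subset_left Metric.isBounded_closedBall
        _ ≤ 2 * 1 := Metric.diam_closedBall zero_le_one
        _ < 1 / e := by rw [lt_div_iff₀ he]; linarith)
    (by
      rw [Metric.le_infDist ⟨u, huC⟩]
      rintro w ⟨-, hw⟩
      rw [dist_zero_left]
      exact hw.trans ((le_abs_self _).trans (hf' w)))
  have hx₀ := add_le_norm_of_le_infDist_closedBall hr₀.le (by positivity) hdist
  rw [sub_zero] at hx₀
  have hx₀pos : 0 < ‖x₀‖ := by linarith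
  have hx₀K : ‖x₀‖ ≤ K + 1 := by
    have h1 := mem_closedBall_iff_norm.1 (hsub huC)
    have h2 := norm_sub_le u (u - x₀)
    rw [sub_sub_cancel] at h2
    linarith
  have hx1 : ‖‖x₀‖⁻¹ • x₀‖ = 1 := by
    rw [norm_smul, norm_inv, norm_norm, inv_mul_cancel₀ hx₀pos.ne']
  refine ⟨‖x₀‖⁻¹ • x₀, hx1, fun g hg hgx => ?_⟩
  have hδ : e / (4 * (K + 1)) * ‖x₀‖ ≤ e / 4 := by
    rw [div_mul_eq_mul_div, div_le_div_iff₀ (by positivity) (by positivity)]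
    nlinarith
  have hδe : e / (4 * (K + 1)) ≤ e := div_le_self he.le (by linarith)
  refine (norm_sub_le_of_nonneg_on_slice hf hg he he4 (fun w hw hfw => ?_) hx1
    (by linarith)).trans heε
  have h1 := mem_closedBall_iff_norm.1 (hsub ⟨by simpa using hw, hfw⟩)
  have h2 : g x₀ - g w ≤ ‖w - x₀‖ := by
    rw [← map_sub, norm_sub_rev]
    exact (le_abs_self _).trans
      ((g.le_opNorm _).trans (mul_le_of_le_one_left (norm_nonneg _) hg))
  rw [map_smul, smul_eq_mul, inv_mul_eq_div, lt_div_iff₀ hx₀pos] at hgx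
  linarith

/-- A functional of norm one separating a convex set from a point at distance `ε`. -/
theorem exists_norm_eq_one_add_le_apply {X : Type*} [NormedAddCommGroup X] [NormedSpace ℝ X]
    {C : Set X} (hne : C.Nonempty) (hC : Convex ℝ C) {p : X} {ε : ℝ} (hε : 0 < ε)
    (h : ε ≤ Metric.infDist p C) :
    ∃ f : StrongDual ℝ X, ‖f‖ = 1 ∧ ∀ c ∈ C, ε ≤ f (c - p) := by
  rw [Metric.le_infDist hne] at h
  obtain ⟨f, t, hfb, hfC⟩ := geometric_hahn_banach_open (convex_ball p ε) Metric.isOpen_ball hC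
    (Set.disjoint_left.2 fun y hy hyC => by
      have := h hyC
      rw [Metric.mem_ball, dist_comm] at hy
      linarith)
  have hbound : ε * ‖f‖ ≤ t - f p := by
    refine le_of_forall_lt fun s hs => ?_
    rw [← div_lt_iff₀' hε] at hs
    obtain ⟨u, hu, hfu⟩ := exists_norm_lt_one_lt_apply f hs
    have := hfb (p + ε • u) (by
      rw [mem_ball_iff_norm, add_sub_cancel_left, norm_smul, Real.norm_of_nonneg hε.le]
      nlinarith)
    rw [map_add, map_smul, smul_eq_mul] at this
    rw [div_lt_iff₀' hε] at hfu
    linarith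
  have hf0 : 0 < ‖f‖ := by
    obtain ⟨c, hc⟩ := hne
    rw [norm_pos_iff]
    rintro rfl
    have h1 := hfb p (Metric.mem_ball_self hε)
    have h2 := hfC c hc
    simp only [zero_apply] at h1 h2
    linarith
  refine ⟨‖f‖⁻¹ • f, by rw [norm_smul, norm_inv, norm_norm, inv_mul_cancel₀ hf0.ne'],
    fun c hc => ?_⟩
  rw [smul_apply, smul_eq_mul, inv_mul_eq_div, le_div_iff₀ hf0, map_sub]
  linarith [hfC c hc]

theorem HasUniformlySemidentingDual.hasUMIP {X : Type*} [NormedAddCommGroup X] [NormedSpace ℝ X]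
    (h : HasUniformlySemidentingDual X) : HasUMIP X := by
  intro ε hε
  set D := 1 / ε with hD_def
  have hD : 0 < D := by positivity
  set R := D + ε / 2 with hR_def
  have hR : 0 < R := by positivity
  obtain ⟨δ, hδ, hslice⟩ := h (ε / (2 * R)) (by positivity)
  -- Large enough that functionals outside the slice lose `l * δ ≥ R + ε / 2` at `l • x`; the extra
  -- `ε` keeps the radius `l - ε / 2` positive.
  set l := (R + ε / 2) / δ + ε with hl_def
  have hlδ : R + ε / 2 ≤ l * δ := by
    rw [hl_def, add_mul, div_mul_cancel₀ _ hδ.ne']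
    nlinarith
  have hlε : ε ≤ l := le_add_of_nonneg_left (by positivity)
  refine ⟨D + l, by positivity, fun C hne _ hbdd hconv p hdiam hdist => ?_⟩
  -- If some point of `C` is far from `p`, the ball of radius `D` about it suffices. Otherwise `C`
  -- lies within `R` of `p`.
  by_cases hfar : ∃ c ∈ C, R ≤ ‖c - p‖
  · obtain ⟨c, hc, hcp⟩ := hfar
    refine ⟨c, D, hD, by linarith, fun y hy => ?_, le_infDist_closedBall hD.le hcp⟩
    exact (Metric.dist_le_diam_of_mem hbdd hy hc).trans hdiam.le
  push Not at hfar
  obtain ⟨f, hf, hfC⟩ := exists_norm_eq_one_add_le_apply hne hconv hε hdist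
  obtain ⟨x, hx, hxg⟩ := hslice f hf
  refine ⟨p + l • x, l - ε / 2, by linarith, by linarith, fun c hc => ?_,
    le_infDist_closedBall (by linarith) ?_⟩
  · have hw := hfar c hc
    have hfw := hfC c hc
    rw [mem_closedBall_iff_norm, norm_sub_rev, show p + l • x - c = l • x - (c - p) by abel]
    set w := c - p
    -- If the norming `g` is in the slice, `g w ≥ f w - ε / 2 ≥ ε / 2`; if not, the loss at `l • x`
    -- outweighs `‖w‖ < R`.
    obtain ⟨g, hg, hgn⟩ := exists_dual_vector'' ℝ (l • x - w)
    rw [← show g (l • x - w) = ‖l • x - w‖ from hgn, map_sub, map_smul, smul_eq_mul]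
    have hgw : |g w| ≤ ‖w‖ := (g.le_opNorm w).trans (mul_le_of_le_one_left (norm_nonneg _) hg)
    have hgx : g x ≤ 1 := by
      have := (g.le_opNorm x).trans (mul_le_of_le_one_left (norm_nonneg _) hg)
      exact (le_abs_self _).trans (this.trans hx.le)
    rcases lt_or_ge (1 - δ) (g x) with hgδ | hgδ
    · have h1 : f w - g w ≤ ε / (2 * R) * ‖w‖ :=
        (le_abs_self _).trans ((f - g).le_of_opNorm_le (hxg g hg hgδ) w)
      have h2 : ε / (2 * R) * ‖w‖ ≤ ε / 2 := by
        rw [div_mul_eq_mul_div, div_le_div_iff₀ (by positivity) (by positivity)]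
        nlinarith
      nlinarith
    · have := neg_le_of_abs_le hgw
      nlinarith
  · rw [add_sub_cancel_left, norm_smul, hx, Real.norm_of_nonneg (by linarith)]
    linarith

/-! ### Slices and the gap in Young's inequality -/

/-- A uniform version of the strict case of Young's inequality `b ≤ 1 - 1 / q + b ^ q / q`. -/
theorem exists_mul_rpow_le_young_gap {q : ℝ} (hq : 1 < q) {η : ℝ} (hη : 0 < η) :
    ∃ c : ℝ, 0 < c ∧ ∀ b : ℝ, 0 ≤ b → η ≤ |1 - b| →
      c * (1 + b) ^ q ≤ 1 - 1 / q + b ^ q / q - b := by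
  have hq0 : 0 < q := by linarith
  have hgap (b : ℝ) (hb : 0 ≤ b) (hne : b ≠ 1) : 0 < 1 - 1 / q + b ^ q / q - b := by
    have := one_add_mul_self_lt_rpow_one_add (s := b - 1) (by linarith) (sub_ne_zero.2 hne) hq
    rw [add_sub_cancel] at this
    have h2 : (1 + q * (b - 1)) / q < b ^ q / q := by gcongr
    rw [show (1 + q * (b - 1)) / q = 1 / q + b - 1 by field_simp; ring] at h2
    linarith
  -- Beyond `M`, half of `b ^ q / q` absorbs `b`; below `M`, compactness bounds the gap away from 0.
  obtain ⟨M, hM1, hM⟩ : ∃ M : ℝ, 1 ≤ M ∧ ∀ b, M ≤ b → 2 * q ≤ b ^ (q - 1) := by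
    obtain ⟨M, hM⟩ := Filter.eventually_atTop.1
      ((tendsto_rpow_atTop (show 0 < q - 1 by linarith)).eventually_ge_atTop (2 * q))
    exact ⟨max M 1, le_max_right _ _, fun b hb => hM b ((le_max_left _ _).trans hb)⟩
  set S : Set ℝ := Set.Icc 0 M ∩ {b | η ≤ |1 - b|} with hS
  have hScomp : IsCompact S := isCompact_Icc.inter_right
    (isClosed_le continuous_const (by fun_prop))
  obtain ⟨c₁, hc₁, hc₁S⟩ : ∃ c : ℝ, 0 < c ∧ ∀ b ∈ S,
      c ≤ 1 - 1 / q + b ^ q / q - b := by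
    rcases S.eq_empty_or_nonempty with hem | hne
    · exact ⟨1, one_pos, by simp [hem]⟩
    · have hcont : Continuous fun b : ℝ => 1 - 1 / q + b ^ q / q - b := by
        have := Real.continuous_rpow_const hq0.le
        fun_prop
      obtain ⟨b₀, hb₀, hmin⟩ := hScomp.exists_isMinOn hne hcont.continuousOn
      refine ⟨_, hgap b₀ hb₀.1.1 ?_, fun b hb => hmin hb⟩
      rintro rfl
      have := hb₀.2
      simp only [Set.mem_ofPred_eq, sub_self, abs_zero] at this
      linarith
  have h1M : 0 < (1 + M) ^ q := by positivity
  refine ⟨min (c₁ / (1 + M) ^ q) (1 / (2 * q * 2 ^ q)), by positivity, fun b hb hbη => ?_⟩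
  rcases le_total b M with hbM | hbM
  · calc _ ≤ c₁ / (1 + M) ^ q * (1 + M) ^ q := by
          gcongr
          exact min_le_left _ _
      _ = c₁ := div_mul_cancel₀ _ h1M.ne'
      _ ≤ _ := hc₁S b ⟨⟨hb, hbM⟩, hbη⟩
  · have hb1 : 1 ≤ b := hM1.trans hbM
    have hbq : b ^ q = b ^ (q - 1) * b := by
      rw [← Real.rpow_add_one (by linarith), sub_add_cancel]
    have h1 : 2 * q * b ≤ b ^ q := by
      rw [hbq]
      gcongr
      exact hM b hbM
    have h1q : 1 / q ≤ 1 := by rw [div_le_one hq0]; exact hq.le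
    calc _ ≤ 1 / (2 * q * 2 ^ q) * (2 * b) ^ q := by
          gcongr
          · exact min_le_right _ _
          · linarith
      _ = b ^ q / (2 * q) := by
          rw [Real.mul_rpow zero_le_two hb]
          field_simp
      _ ≤ b ^ q / q - b := by
          rw [show b ^ q / q - b = b ^ q / (2 * q) + (b ^ q - 2 * q * b) / (2 * q) by
            field_simp; ring]
          exact le_add_of_nonneg_right (div_nonneg (by linarith) (by positivity))
      _ ≤ _ := by linarith

/-- The gap is the Young gap of `‖g‖` plus `‖g‖ - g x`. The first is large when `‖g‖` is away from
1, the second when `g / ‖g‖` misses the slice; otherwise `‖f - g‖ ≤ 2θ`. The bound `c ≤ 1 / q`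
serves the case `f = 0` after homogenising. -/
theorem exists_rpow_norm_sub_le_of_norm_eq_one {X : Type*} [NormedAddCommGroup X]
    [NormedSpace ℝ X] (h : HasUniformlySemidentingDual X) {q : ℝ} (hq : 1 < q) {η : ℝ}
    (hη : 0 < η) :
    ∃ c : ℝ, 0 < c ∧ c ≤ 1 / q ∧ ∀ f : StrongDual ℝ X, ‖f‖ = 1 → ∃ x : X, ‖x‖ = 1 ∧
      ∀ g : StrongDual ℝ X, c * ‖f - g‖ ^ q ≤ c * η + (1 - 1 / q + ‖g‖ ^ q / q - g x) := by
  have hq0 : 0 < q := by linarith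
  obtain ⟨θ, hθ, hθ2, hθη⟩ : ∃ θ : ℝ, 0 < θ ∧ θ ≤ 1 / 2 ∧ (2 * θ) ^ q ≤ η := by
    refine ⟨min (1 / 2) (η ^ (1 / q) / 2), by positivity, min_le_left _ _, ?_⟩
    calc _ ≤ (η ^ (1 / q)) ^ q := by
          gcongr
          linarith [min_le_right (1 / 2) (η ^ (1 / q) / 2)]
      _ = η := by rw [← Real.rpow_mul hη.le, one_div_mul_cancel hq0.ne', Real.rpow_one]
  obtain ⟨δ, hδ, hslice⟩ := h θ hθ
  obtain ⟨c₀, hc₀, hgap⟩ := exists_mul_rpow_le_young_gap hq hθ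
  have h3 : (0 : ℝ) < 3 ^ q := by positivity
  obtain ⟨c, hc, hcq, hcc₀, hcδ⟩ :
      ∃ c : ℝ, 0 < c ∧ c ≤ 1 / q ∧ c ≤ c₀ ∧ c ≤ δ / (2 * 3 ^ q) :=
    ⟨min (1 / q) (min c₀ (δ / (2 * 3 ^ q))), by positivity, min_le_left _ _,
      (min_le_right _ _).trans (min_le_left _ _), (min_le_right _ _).trans (min_le_right _ _)⟩
  refine ⟨c, hc, hcq, fun f hf => ?_⟩
  obtain ⟨x, hx, hxg⟩ := hslice f hf
  refine ⟨x, hx, fun g => ?_⟩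
  have hgx : g x ≤ ‖g‖ := by simpa [hx] using (le_abs_self _).trans (g.le_opNorm x)
  have hfg : ‖f - g‖ ≤ 1 + ‖g‖ := by simpa [hf] using norm_sub_le f g
  have hcη : 0 < c * η := by positivity
  rcases le_total θ |1 - ‖g‖| with hb | hb
  · have h1 := hgap ‖g‖ (norm_nonneg g) hb
    have h2 : c * ‖f - g‖ ^ q ≤ c₀ * (1 + ‖g‖) ^ q := by
      gcongr
    linarith
  have hb' := abs_le.1 hb
  have hg0 : 0 < ‖g‖ := by linarith
  have hyoung : ‖g‖ ≤ 1 - 1 / q + ‖g‖ ^ q / q := by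
    have := one_add_mul_self_le_rpow_one_add (s := ‖g‖ - 1) (by linarith) hq.le
    rw [add_sub_cancel] at this
    have h2 : (1 + q * (‖g‖ - 1)) / q ≤ ‖g‖ ^ q / q := by gcongr
    rw [show (1 + q * (‖g‖ - 1)) / q = 1 / q + ‖g‖ - 1 by field_simp; ring] at h2
    linarith
  rcases lt_or_ge (1 - δ) (g x / ‖g‖) with hs | hs
  · have h1 : ‖f - ‖g‖⁻¹ • g‖ ≤ θ := by
      refine hxg _ ?_ ?_
      · rw [norm_smul, norm_inv, norm_norm, inv_mul_cancel₀ hg0.ne']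
      · rwa [smul_apply, smul_eq_mul, inv_mul_eq_div]
    have h2 : ‖‖g‖⁻¹ • g - g‖ = |1 - ‖g‖| := by
      rw [show ‖g‖⁻¹ • g - g = (‖g‖⁻¹ - 1) • g by ext v; simp [sub_mul], norm_smul,
        Real.norm_eq_abs]
      nth_rewrite 2 [← abs_norm g]
      rw [← abs_mul, sub_mul, one_mul, inv_mul_cancel₀ hg0.ne']
    have h4 : ‖f - g‖ ≤ 2 * θ := by
      have := norm_sub_le_norm_sub_add_norm_sub f (‖g‖⁻¹ • g) g
      linarith
    have h5 : c * ‖f - g‖ ^ q ≤ c * η := by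
      gcongr
      exact (Real.rpow_le_rpow (norm_nonneg _) h4 hq0.le).trans hθη
    linarith
  · rw [div_le_iff₀ hg0] at hs
    have h1 : c * ‖f - g‖ ^ q ≤ δ / (2 * 3 ^ q) * 3 ^ q := by
      gcongr
      linarith
    rw [show δ / (2 * 3 ^ q) * 3 ^ q = δ / 2 by field_simp] at h1
    nlinarith

/-- Rescaling by `1 / ‖f‖` reduces to norm one. The norm of `y` makes `‖y‖ ^ p = ‖f‖ ^ q` for
conjugate exponents, so the coordinate vectors assemble into an element of `ℓ_p(X)`. -/
theorem exists_rpow_norm_sub_le {X : Type*} [NormedAddCommGroup X] [NormedSpace ℝ X]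
    (h : HasUniformlySemidentingDual X) {q : ℝ} (hq : 1 < q) {η : ℝ} (hη : 0 < η) :
    ∃ c : ℝ, 0 < c ∧ ∀ f : StrongDual ℝ X, ∃ y : X, ‖y‖ = ‖f‖ ^ (q - 1) ∧
      ∀ g : StrongDual ℝ X, c * ‖f - g‖ ^ q ≤
        c * η * ‖f‖ ^ q + ((1 - 1 / q) * ‖f‖ ^ q + 1 / q * ‖g‖ ^ q - g y) := by
  have hq0 : 0 < q := by linarith
  obtain ⟨c, hc, hcq, hcf⟩ := exists_rpow_norm_sub_le_of_norm_eq_one h hq hη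
  refine ⟨c, hc, fun f => ?_⟩
  rcases eq_or_ne f 0 with rfl | hf
  · refine ⟨0, by simp [Real.zero_rpow (show q - 1 ≠ 0 by linarith)], fun g => ?_⟩
    have : c * ‖g‖ ^ q ≤ 1 / q * ‖g‖ ^ q := by
      gcongr
    simpa [Real.zero_rpow hq0.ne'] using this
  have ha : 0 < ‖f‖ := norm_pos_iff.2 hf
  set a := ‖f‖ with ha_def
  obtain ⟨x, hx, hxg⟩ := hcf (a⁻¹ • f)
    (by rw [norm_smul, norm_inv, Real.norm_of_nonneg ha.le, inv_mul_cancel₀ ha.ne'])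
  have haq : 0 < a ^ q := by positivity
  refine ⟨a ^ (q - 1) • x, by
    rw [norm_smul, hx, mul_one, Real.norm_of_nonneg (by positivity)], fun g => ?_⟩
  have h1 := mul_le_mul_of_nonneg_left (hxg (a⁻¹ • g)) haq.le
  have hscale (k : StrongDual ℝ X) : a ^ q * ‖a⁻¹ • k‖ ^ q = ‖k‖ ^ q := by
    rw [norm_smul, norm_inv, Real.norm_of_nonneg ha.le, ← Real.mul_rpow ha.le (by positivity),
      mul_inv_cancel_left₀ ha.ne']
  have hpow : a ^ (q - 1) = a ^ q * a⁻¹ := by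
    rw [Real.rpow_sub_one ha.ne', div_eq_mul_inv]
  rw [smul_apply, smul_eq_mul,
    show a⁻¹ • f - a⁻¹ • g = a⁻¹ • (f - g) by ext v; simp [mul_sub]] at h1
  rw [map_smul, smul_eq_mul, hpow, ← hscale (f - g), ← hscale g]
  calc _ = a ^ q * (c * ‖a⁻¹ • (f - g)‖ ^ q) := by ring
    _ ≤ _ := h1
    _ = _ := by ring

/-! ### Duality for `ℓ_p(X)` and passage of the dual condition to it -/

/-- The `i`-th coordinate of a functional on `ℓ_p(X)`. -/
noncomputable def dualCoord {X : Type*} [NormedAddCommGroup X] [NormedSpace ℝ X] {p : ENNReal}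
    [Fact (1 ≤ p)] (F : StrongDual ℝ (lp (fun _ : ℕ => X) p)) (i : ℕ) : StrongDual ℝ X :=
  F.comp (lp.singleContinuousLinearMap ℝ (fun _ : ℕ => X) p i)

theorem hasSum_dualCoord_apply {X : Type*} [NormedAddCommGroup X] [NormedSpace ℝ X] {p : ENNReal}
    [Fact (1 ≤ p)] (hp : p ≠ ⊤) (F : StrongDual ℝ (lp (fun _ : ℕ => X) p))
    (x : lp (fun _ : ℕ => X) p) : HasSum (fun i => dualCoord F i (x i)) (F x) :=
  F.hasSum (lp.hasSum_single hp x)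

/-- The equality case of Hölder, tested on almost norming vectors: norms need not be attained, hence
the factor `t < 1`, which is then sent to 1. -/
theorem sum_rpow_norm_dualCoord_le {X : Type*} [NormedAddCommGroup X] [NormedSpace ℝ X]
    {p : ENNReal} [Fact (1 ≤ p)] {q : ℝ} (hpq : p.toReal.HolderConjugate q)
    (F : StrongDual ℝ (lp (fun _ : ℕ => X) p)) (s : Finset ℕ) :
    ∑ i ∈ s, ‖dualCoord F i‖ ^ q ≤ ‖F‖ ^ q := by
  have hp0 := hpq.pos
  have hq0 := hpq.symm.pos
  set S := ∑ i ∈ s, ‖dualCoord F i‖ ^ q with hS_def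
  have hS0 : 0 ≤ S := Finset.sum_nonneg fun i _ => by positivity
  rcases hS0.eq_or_lt with hS | hS
  · rw [← hS]
    positivity
  have key (t : ℝ) (ht0 : 0 < t) (ht1 : t < 1) : t * S ≤ ‖F‖ * S ^ (1 / p.toReal) := by
    have hz (i : ℕ) : ∃ z : X, ‖z‖ ≤ ‖dualCoord F i‖ ^ (q - 1) ∧
        t * ‖dualCoord F i‖ ^ q ≤ dualCoord F i z := by
      rcases eq_or_ne (dualCoord F i) 0 with h0 | h0
      · exact ⟨0, by simp only [norm_zero]; positivity, by simp [h0, Real.zero_rpow hq0.ne']⟩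
      have hn : 0 < ‖dualCoord F i‖ := norm_pos_iff.2 h0
      obtain ⟨u, hu, htu⟩ := exists_norm_lt_one_lt_apply (dualCoord F i)
        (t := t * ‖dualCoord F i‖) (by nlinarith)
      refine ⟨‖dualCoord F i‖ ^ (q - 1) • u, ?_, ?_⟩
      · rw [norm_smul, Real.norm_of_nonneg (by positivity)]
        exact mul_le_of_le_one_right (by positivity) hu.le
      · have : ‖dualCoord F i‖ ^ q = ‖dualCoord F i‖ ^ (q - 1) * ‖dualCoord F i‖ := by
          rw [← Real.rpow_add_one hn.ne', sub_add_cancel]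
        rw [map_smul, smul_eq_mul, this, mul_left_comm]
        gcongr
    choose z hzn hzF using hz
    calc t * S ≤ ∑ i ∈ s, dualCoord F i (z i) := by
          rw [hS_def, Finset.mul_sum]
          exact Finset.sum_le_sum fun i _ => hzF i
      _ = F (∑ i ∈ s, lp.single p i (z i)) := by
          rw [map_sum]
          rfl
      _ ≤ ‖F‖ * ‖∑ i ∈ s, lp.single (E := fun _ : ℕ => X) p i (z i)‖ :=
          (le_abs_self _).trans (F.le_opNorm _)
      _ ≤ ‖F‖ * S ^ (1 / p.toReal) := by
          gcongr
          rw [one_div, Real.le_rpow_inv_iff_of_pos (norm_nonneg _) hS0 hp0,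
            lp.norm_sum_single hp0, hS_def]
          refine Finset.sum_le_sum fun i _ => ?_
          calc ‖z i‖ ^ p.toReal ≤ (‖dualCoord F i‖ ^ (q - 1)) ^ p.toReal := by
                gcongr
                exact hzn i
            _ = ‖dualCoord F i‖ ^ q := by
                rw [← Real.rpow_mul (norm_nonneg _), hpq.symm.sub_one_mul_conj]
  have h1 : S ≤ ‖F‖ * S ^ (1 / p.toReal) := by
    refine le_of_forall_lt fun r hr => ?_
    obtain ⟨r', hr', hr'S⟩ := exists_between (max_lt hr hS)
    have hr0 := (le_max_right r 0).trans_lt hr'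
    have := key (r' / S) (by positivity) ((div_lt_one hS).2 hr'S)
    rw [div_mul_cancel₀ _ hS.ne'] at this
    exact ((le_max_left r 0).trans_lt hr').trans_le this
  have h2 : S = S ^ (1 / q) * S ^ (1 / p.toReal) := by
    rw [← Real.rpow_add hS, one_div, one_div, hpq.symm.inv_add_inv_eq_one, Real.rpow_one]
  nth_rewrite 1 [h2] at h1
  have h3 := le_of_mul_le_mul_right h1 (by positivity)
  rwa [one_div, Real.rpow_inv_le_iff_of_pos hS0 (norm_nonneg _) hq0] at h3

/-- The dual norm of `ℓ_p(X)` is the `ℓ_q` norm of the coordinate functionals. -/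
theorem hasSum_rpow_norm_dualCoord {X : Type*} [NormedAddCommGroup X] [NormedSpace ℝ X]
    {p : ENNReal} [Fact (1 ≤ p)] (hp : p ≠ ⊤) {q : ℝ} (hpq : p.toReal.HolderConjugate q)
    (F : StrongDual ℝ (lp (fun _ : ℕ => X) p)) :
    HasSum (fun i => ‖dualCoord F i‖ ^ q) (‖F‖ ^ q) := by
  have hp0 := hpq.pos
  have hq0 := hpq.symm.pos
  have hsum : Summable fun i => ‖dualCoord F i‖ ^ q :=
    summable_of_sum_le (fun i => by positivity) (sum_rpow_norm_dualCoord_le hpq F)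
  have hT0 : 0 ≤ ∑' i, ‖dualCoord F i‖ ^ q := tsum_nonneg fun i => by positivity
  suffices ‖F‖ ^ q = ∑' i, ‖dualCoord F i‖ ^ q by
    rw [this]
    exact hsum.hasSum
  refine le_antisymm ?_ (hsum.tsum_le_of_sum_le (sum_rpow_norm_dualCoord_le hpq F))
  rw [← Real.le_rpow_inv_iff_of_pos (norm_nonneg _) hT0 hq0, ← one_div]
  refine F.opNorm_le_bound (by positivity) fun x => ?_
  have hx := lp.hasSum_norm hp0 x
  have hprod := Real.summable_and_inner_le_Lp_mul_Lq_tsum_of_nonneg hpq.symm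
    (fun i => norm_nonneg (dualCoord F i)) (fun i => norm_nonneg (x i)) hsum hx.summable
  have hnorm : ‖x‖ = (∑' i, ‖x i‖ ^ p.toReal) ^ (1 / p.toReal) := by
    rw [hx.tsum_eq, one_div, Real.rpow_rpow_inv (norm_nonneg _) hp0.ne']
  rw [hnorm]
  refine le_trans ?_ hprod.2
  rw [← (hasSum_dualCoord_apply hp F x).tsum_eq]
  exact tsum_of_norm_bounded hprod.1.hasSum fun i => (dualCoord F i).le_opNorm _

theorem HasUniformlySemidentingDual.lp {X : Type*} [NormedAddCommGroup X] [NormedSpace ℝ X]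
    (h : HasUniformlySemidentingDual X) {p : ENNReal} [Fact (1 ≤ p)] (hp : 1 < p) (hp_top : p ≠ ⊤) :
    HasUniformlySemidentingDual (lp (fun _ : ℕ => X) p) := by
  have hp1 : 1 < p.toReal := by
    rwa [← ENNReal.toReal_one, ENNReal.toReal_lt_toReal ENNReal.one_ne_top hp_top]
  set q := p.toReal.conjExponent with hq_def
  have hpq : p.toReal.HolderConjugate q := Real.HolderConjugate.conjExponent hp1
  have hp0 := hpq.pos
  have hq0 := hpq.symm.pos
  intro ε hε
  obtain ⟨c, hc, hcf⟩ := exists_rpow_norm_sub_le h hpq.symm.lt (η := ε ^ q / 2) (by positivity)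
  refine ⟨c * (ε ^ q / 2), by positivity, fun F hF => ?_⟩
  have hFs := hasSum_rpow_norm_dualCoord hp_top hpq F
  rw [hF, Real.one_rpow] at hFs
  choose y hyn hyg using fun i => hcf (dualCoord F i)
  have hys : HasSum (fun i => ‖y i‖ ^ p.toReal) 1 := by
    convert hFs using 2 with i
    rw [hyn, ← Real.rpow_mul (norm_nonneg _), hpq.symm.sub_one_mul_conj]
  refine ⟨⟨y, memℓp_gen hys.summable⟩, ?_, fun G hG hGy => ?_⟩
  · rw [lp.norm_eq_tsum_rpow hp0]
    simp only [hys.tsum_eq, Real.one_rpow]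
  · have hGs := hasSum_rpow_norm_dualCoord hp_top hpq G
    have hGq : ‖G‖ ^ q ≤ 1 := Real.rpow_le_one (norm_nonneg _) hG hq0.le
    -- Summed, the Young terms give at most `1 - G y < c * (ε ^ q / 2)`, and the error term gives
    -- another `c * (ε ^ q / 2)`.
    have hle := hasSum_le (fun i => hyg i (dualCoord G i))
      ((hasSum_rpow_norm_dualCoord hp_top hpq (F - G)).mul_left c)
      ((hFs.mul_left _).add (((hFs.mul_left _).add (hGs.mul_left _)).sub
        (hasSum_dualCoord_apply hp_top G ⟨y, memℓp_gen hys.summable⟩)))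
    rw [← Real.rpow_le_rpow_iff (norm_nonneg _) hε.le hq0]
    have h1 : 1 / q * ‖G‖ ^ q ≤ 1 / q * 1 := by gcongr
    refine le_of_mul_le_mul_left ?_ hc
    linarith

/-! ### Descent from `ℓ_p(X)` to `X` -/

/-- Minkowski's inequality in the plane for `(a, s)` and `(e, 0)`. -/
theorem add_rpow_rpow_inv_le {a s e p : ℝ} (hp : 1 ≤ p) (ha : 0 ≤ a) (hs : 0 ≤ s) (he : 0 ≤ e) :
    ((a + e) ^ p + s ^ p) ^ (1 / p) ≤ (a ^ p + s ^ p) ^ (1 / p) + e := by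
  have h := Real.Lp_add_le_of_nonneg (s := Finset.univ) (f := ![a, s]) (g := ![e, 0]) hp
    (by simp [Fin.forall_fin_two, ha, hs]) (by simp [Fin.forall_fin_two, he])
  have hp0 : p ≠ 0 := by linarith
  simpa [Fin.sum_univ_two, Real.zero_rpow hp0, Real.rpow_rpow_inv he hp0] using h

theorem HasUMIP.of_lp {X : Type*} [NormedAddCommGroup X] [NormedSpace ℝ X] [CompleteSpace X]
    {p : ENNReal} [Fact (1 ≤ p)] (hp_top : p ≠ ⊤) (h : HasUMIP (lp (fun _ : ℕ => X) p)) :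
    HasUMIP X := by
  have hp1 : 1 ≤ p.toReal := by
    rw [← ENNReal.toReal_one]
    exact ENNReal.toReal_mono hp_top Fact.out
  have hp0 : 0 < p.toReal := by linarith
  intro ε hε
  obtain ⟨K, hK, hball⟩ := h ε hε
  refine ⟨K + ε / 2, by positivity, fun C hne hcl hbdd hconv x hdiam hdist => ?_⟩
  have hiso : Isometry (lp.singleContinuousLinearMap ℝ (fun _ : ℕ => X) p 0) :=
    lp.isometry_single (E := fun _ : ℕ => X) (p := p) 0
  set J := lp.singleContinuousLinearMap ℝ (fun _ : ℕ => X) p 0 with hJ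
  obtain ⟨y, r, hr, hrK, hsub, hyx⟩ := hball (J '' C) (hne.image _)
    (hiso.isClosedEmbedding.isClosedMap _ hcl)
    (hiso.lipschitz.isBounded_image hbdd) (hconv.linear_image J.toLinearMap) (J x)
    (by rwa [hiso.diam_image]) (by rwa [Metric.infDist_image hiso])
  have hyx' := add_le_norm_of_le_infDist_closedBall hr.le (by positivity) hyx
  set s := ‖y - J (y 0)‖ with hs
  have hs0 : 0 ≤ s := norm_nonneg _
  have hnorm (c : X) : ‖y - J c‖ ^ p.toReal = ‖y 0 - c‖ ^ p.toReal + s ^ p.toReal := by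
    have h1 := lp.norm_compl_sum_single hp0 (y - J c) {0}
    have h2 : (y - J c) 0 = y 0 - c := by
      simp [hJ]
    rw [Finset.sum_singleton, Finset.sum_singleton, h2, lp.single_sub] at h1
    have h3 : y - J c - (lp.single p 0 (y 0) - lp.single p 0 c) = y - J (y 0) := by
      simp only [hJ, lp.singleContinuousLinearMap_apply]
      abel
    rw [h3] at h1
    linarith
  have hC (c : X) (hc : c ∈ C) : ‖y 0 - c‖ ^ p.toReal + s ^ p.toReal ≤ r ^ p.toReal := by
    have := mem_closedBall_iff_norm'.1 (hsub (Set.mem_image_of_mem J hc))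
    rw [← hnorm]
    gcongr
  have hsr : s ^ p.toReal ≤ r ^ p.toReal := by
    obtain ⟨c, hc⟩ := hne
    have := hC c hc
    have : 0 ≤ ‖y 0 - c‖ ^ p.toReal := by positivity
    linarith
  -- The radius of the section of the ball by the copy of `X`, whose centre is `y 0`.
  set a := (r ^ p.toReal - s ^ p.toReal) ^ (p.toReal)⁻¹ with ha
  have ha0 : 0 ≤ a := Real.rpow_nonneg (sub_nonneg.2 hsr) _
  have hap : a ^ p.toReal + s ^ p.toReal = r ^ p.toReal := by
    rw [ha, Real.rpow_inv_rpow (sub_nonneg.2 hsr) hp0.ne', sub_add_cancel]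
  have har : a ≤ r := by
    rw [← Real.rpow_le_rpow_iff ha0 hr.le hp0]
    have : 0 ≤ s ^ p.toReal := by positivity
    linarith
  have hCa (c : X) (hc : c ∈ C) : ‖y 0 - c‖ ≤ a := by
    rw [← Real.rpow_le_rpow_iff (norm_nonneg _) ha0 hp0]
    linarith [hC c hc]
  -- A section of radius 0 forces `C` to be a single point, and a ball of radius `ε / 2` about it is
  -- used instead.
  rcases ha0.eq_or_lt with ha' | ha'
  · obtain ⟨c, hc⟩ := hne
    refine ⟨c, ε / 2, by positivity, by linarith, fun z hz => ?_,
      le_infDist_closedBall (by positivity) ?_⟩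
    · have h1 := hCa c hc
      have h2 := hCa z hz
      rw [← ha', norm_le_zero_iff, sub_eq_zero] at h1 h2
      rw [← h1, ← h2]
      exact Metric.mem_closedBall_self (by positivity)
    · rw [Metric.le_infDist ⟨c, hc⟩] at hdist
      have := hdist hc
      rw [dist_comm, dist_eq_norm] at this
      linarith
  · refine ⟨y 0, a, ha', by linarith, fun c hc => mem_closedBall_iff_norm'.2 (hCa c hc),
      le_infDist_closedBall ha'.le ?_⟩
    by_contra! hlt
    have h1 := add_rpow_rpow_inv_le (e := ε / 2) hp1 ha0 hs0 (by positivity)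
    rw [hap, one_div, Real.rpow_rpow_inv hr.le hp0.ne',
      Real.rpow_inv_le_iff_of_pos (by positivity) (by positivity) hp0] at h1
    have h2 : ‖y 0 - x‖ ^ p.toReal < (a + ε / 2) ^ p.toReal := by gcongr
    have h3 : (r + ε / 2) ^ p.toReal ≤ ‖y - J x‖ ^ p.toReal := by gcongr
    rw [hnorm] at h3
    linarith

/-- Here `lp (fun _ : ℕ => X) p` is the space `ℓ_p(X)` of `p`-summable sequences in `X`. -/
theorem mainTheorem6 (X : Type*) [NormedAddCommGroup X] [NormedSpace ℝ X] [CompleteSpace X]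
    (p : ENNReal) [Fact (1 ≤ p)] (hp : 1 < p) (hp_top : p < ⊤) :
    HasUMIP (lp (fun _ : ℕ => X) p) ↔ HasUMIP X :=
  ⟨HasUMIP.of_lp hp_top.ne, fun h =>
    (h.hasUniformlySemidentingDual.lp hp hp_top.ne).hasUMIP⟩
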